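/- Let $G$ be a finite nonempty simple graph. A set $D\subseteq V(G)$ is dominating if every vertex outside $D$ has a neighbour in $D$. For positive integers $k,s$, a $(k,s)$-configuration of $G$ is a multiset of $k$ dominating sets of $G$ such that every vertex of $G$ belongs to at most $s$ of them (counted with multiplicity). The fractional domatic number $FD(G)$ is the supremum of $k/s$ over all positive integers $k,s$ such that $G$ admits a $(k,s)$-configuration. (a) If $G$ has no isolated vertices, then $FD(G)=2$ if and only if $G$ has a vertex of degree $1$ or a connected component isomorphic to the $4$-cycle $C_4$. (b) For every finite nonempty simple graph $G$ (isolated vertices allowed), $FD(G)>2$ if and only if the minimum degree of $G$ is at least $2$ and no connected component of $G$ is isomorphic to $C_4$. -/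

import Mathlib

namespace SimpleGraph

variable {V : Type*} [DecidableEq V]

/-- A set `D` of vertices is dominating if every vertex outside `D` has a neighbour in `D`. -/
def IsDominatingSet (G : SimpleGraph V) (D : Finset V) : Prop :=
  ∀ v, v ∉ D → ∃ u ∈ D, G.Adj v u

/-- A `(k, s)`-configuration: a multiset of `k ≥ 1` dominating sets such that every vertex belongs
to at most `s` of them, counted with multiplicity. -/
def IsConfiguration (G : SimpleGraph V) (k s : ℕ) (𝒟 : Multiset (Finset V)) : Prop :=
  1 ≤ k ∧ Multiset.card 𝒟 = k ∧ (∀ D ∈ 𝒟, G.IsDominatingSet D) ∧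
    ∀ v, Multiset.countP (fun D => v ∈ D) 𝒟 ≤ s

/-- All ratios `k / s` of positive natural numbers such that `G` has a `(k, s)`-configuration. -/
def configurationRatios (G : SimpleGraph V) : Set ℝ :=
  {r | ∃ k s : ℕ, 1 ≤ s ∧ (∃ 𝒟, G.IsConfiguration k s 𝒟) ∧ r = (k : ℝ) / (s : ℝ)}

/-- The fractional domatic number: the supremum of `k / s` over all positive natural numbers
`k`, `s` such that `G` has a `(k, s)`-configuration. For a finite nonempty graph it is a genuine
supremum, see `isLUB_fractionalDomaticNumber`. -/
noncomputable def fractionalDomaticNumber (G : SimpleGraph V) : ℝ :=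
  sSup G.configurationRatios

theorem isLUB_fractionalDomaticNumber [Fintype V] [Nonempty V] (G : SimpleGraph V) :
    IsLUB G.configurationRatios G.fractionalDomaticNumber := by
  refine isLUB_csSup ⟨1, 1, 1, le_rfl, ⟨{Finset.univ}, le_rfl, by simp, ?_, ?_⟩, by simp⟩
    ⟨Fintype.card V, ?_⟩
  · intro D hD v hv
    simp only [Multiset.mem_singleton] at hD
    simp [hD] at hv
  · intro v
    exact (Multiset.countP_le_card _ _).trans (by simp)
  · rintro r ⟨k, s, hs, ⟨𝒟, -, hk, hdom, hcov⟩, rfl⟩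
    have key : ∀ 𝒜 : Multiset (Finset V), (∀ D ∈ 𝒜, G.IsDominatingSet D) →
        Multiset.card 𝒜 ≤ ∑ v : V, Multiset.countP (fun D => v ∈ D) 𝒜 := by
      intro 𝒜
      induction 𝒜 using Multiset.induction_on with
      | empty => simp
      | cons D 𝒜 ih =>
        intro h
        have h1 := ih fun E hE => h E (Multiset.mem_cons_of_mem hE)
        have hne : D.Nonempty := by
          by_contra hD
          rw [Finset.not_nonempty_iff_eq_empty] at hD
          obtain ⟨v⟩ := ‹Nonempty V›
          obtain ⟨u, hu, -⟩ := h D (Multiset.mem_cons_self D 𝒜) v (by simp [hD])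
          simp [hD] at hu
        have h2 : 1 ≤ ∑ v : V, if v ∈ D then 1 else 0 := by
          simpa using hne.card_pos
        simp only [Multiset.card_cons, Multiset.countP_cons, Finset.sum_add_distrib]
        omega
    have h3 : k ≤ Fintype.card V * s := by
      rw [← hk]
      refine (key 𝒟 hdom).trans ((Finset.sum_le_sum fun v _ => hcov v).trans ?_)
      simp
    rw [div_le_iff₀ (by exact_mod_cast hs)]
    exact_mod_cast h3

end SimpleGraph

/-!
The heart of the matter is that minimum degree at least `2` and no `C₄` component force the
fractional domatic number above `2`. Call a multiset of `2s` dominating sets covering every vertex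
at most `s` times *balanced*; it has *slack* at a vertex covered fewer than `s` times. Adding
balanced multisets unites their slack sets (`HasSlack.union`), and slack everywhere means that `2s`
sets cover each vertex at most `s - 1` times, a ratio above `2`. So it suffices to create slack at
one vertex `v` at a time.

Two disjoint vertex sets `A`, `B` form a *cross pair* if every vertex of either has a neighbour in
the other. A cross pair contained in a vertex set `U` that induces no isolated vertex grows greedily
until it covers `U` (`IsCrossPair.exists_extension`). If `v` has distinct neighbours `p`, `q` lying
on opposite sides of some cross pair avoiding `v`, grow this pair to cover all vertices except `v`:
both sides are dominating, and `v` is covered by neither. Such a pair exists if `p` and `q` are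
adjacent, or if they have distinct neighbours other than `v`. Hence it fails to exist only if all
neighbours of `v` have degree `2` and the same second neighbour `c`
(`hasSlack_singleton_or_exists_forall_adj`). If one of these neighbours had the same defect, the
component of `v` would be a `C₄`; so there is slack at all neighbours of `v`. Now take a cross pair
covering all vertices except `v`, its neighbours, and possibly `c`, and enlarge both sides by the
whole neighbourhood of `v`. This covers the neighbours of `v` twice, which their slack pays for,
and leaves out `v` (`HasSlack.singleton_of_neighborFinset`).

The remaining bounds are easy. Growing the empty cross pair gives two disjoint dominating sets, so
the number is at least `2` without isolated vertices. Conversely, every dominating set meets the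
closed neighbourhood of each vertex, and contains two of the four vertices of a `C₄` component;
double counting (`fractionalDomaticNumber_le_of_forall_le_card_inter`) bounds the number by `2` in
the presence of a vertex of degree at most `1` or of a `C₄` component.
-/

namespace SimpleGraph

/-! ### Cross pairs -/

/-- Two disjoint sets of vertices such that every vertex of either set has a neighbour in the other
one. -/
structure IsCrossPair {V : Type*} (G : SimpleGraph V) (A B : Finset V) : Prop where
  disjoint : Disjoint A B
  left : ∀ a ∈ A, ∃ b ∈ B, G.Adj a b
  right : ∀ b ∈ B, ∃ a ∈ A, G.Adj b a

theorem IsCrossPair.symm {V : Type*} {G : SimpleGraph V} {A B : Finset V}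
    (h : G.IsCrossPair A B) : G.IsCrossPair B A :=
  ⟨h.disjoint.symm, h.right, h.left⟩

theorem IsCrossPair.insert_left {V : Type*} [DecidableEq V] {G : SimpleGraph V} {A B : Finset V}
    (h : G.IsCrossPair A B) {u x : V} (hu : u ∉ B) (hx : x ∈ B) (hux : G.Adj u x) :
    G.IsCrossPair (insert u A) B := by
  refine ⟨Finset.disjoint_insert_left.2 ⟨hu, h.disjoint⟩, fun a ha => ?_, fun b hb => ?_⟩
  · rcases Finset.mem_insert.1 ha with rfl | ha
    · exact ⟨x, hx, hux⟩
    · exact h.left a ha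
  · obtain ⟨a, ha, hab⟩ := h.right b hb
    exact ⟨a, Finset.mem_insert_of_mem ha, hab⟩

theorem IsCrossPair.insert_insert {V : Type*} [DecidableEq V] {G : SimpleGraph V} {A B : Finset V}
    (h : G.IsCrossPair A B) {u x : V} (hu : u ∉ B) (hx : x ∉ A) (hux : G.Adj u x) :
    G.IsCrossPair (insert u A) (insert x B) := by
  refine ⟨?_, fun a ha => ?_, fun b hb => ?_⟩
  · rw [Finset.disjoint_insert_left, Finset.disjoint_insert_right, Finset.mem_insert, not_or]
    exact ⟨⟨hux.ne, hu⟩, hx, h.disjoint⟩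
  · rcases Finset.mem_insert.1 ha with rfl | ha
    · exact ⟨x, Finset.mem_insert_self _ _, hux⟩
    · obtain ⟨b, hb, hab⟩ := h.left a ha
      exact ⟨b, Finset.mem_insert_of_mem hb, hab⟩
  · rcases Finset.mem_insert.1 hb with rfl | hb
    · exact ⟨u, Finset.mem_insert_self _ _, hux.symm⟩
    · obtain ⟨a, ha, hab⟩ := h.right b hb
      exact ⟨a, Finset.mem_insert_of_mem ha, hab⟩

theorem isCrossPair_empty {V : Type*} (G : SimpleGraph V) : G.IsCrossPair ∅ ∅ :=
  ⟨by simp, by simp, by simp⟩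

/-- Cross pairs grow greedily: an uncovered vertex joins the side opposite to a covered neighbour,
and two adjacent uncovered vertices join opposite sides. -/
theorem IsCrossPair.exists_extension {V : Type*} [DecidableEq V] {G : SimpleGraph V}
    {U A B : Finset V} (h : G.IsCrossPair A B) (hU : ∀ u ∈ U, ∃ x ∈ U, G.Adj u x)
    (hA : A ⊆ U) (hB : B ⊆ U) :
    ∃ A' B', A ⊆ A' ∧ B ⊆ B' ∧ A' ∪ B' = U ∧ G.IsCrossPair A' B' := by
  induction hn : (U \ (A ∪ B)).card using Nat.strong_induction_on generalizing A B with
  | _ n ih =>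
    subst hn
    by_cases hcov : U ⊆ A ∪ B
    · exact ⟨A, B, subset_rfl, subset_rfl, (Finset.union_subset hA hB).antisymm hcov, h⟩
    obtain ⟨u, huU, hu⟩ := Finset.not_subset.1 hcov
    have step : ∀ A₁ B₁, A ⊆ A₁ → B ⊆ B₁ → A₁ ⊆ U → B₁ ⊆ U → u ∈ A₁ ∪ B₁ → G.IsCrossPair A₁ B₁ →
        ∃ A' B', A ⊆ A' ∧ B ⊆ B' ∧ A' ∪ B' = U ∧ G.IsCrossPair A' B' := by
      intro A₁ B₁ hAA hBB hA₁ hB₁ hu₁ h₁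
      have hlt : (U \ (A₁ ∪ B₁)).card < (U \ (A ∪ B)).card := by
        refine Finset.card_lt_card ⟨Finset.sdiff_subset_sdiff subset_rfl
          (Finset.union_subset_union hAA hBB), fun hsub => ?_⟩
        exact (Finset.mem_sdiff.1 (hsub (Finset.mem_sdiff.2 ⟨huU, hu⟩))).2 hu₁
      obtain ⟨A', B', h1, h2, h3, h4⟩ := ih _ hlt h₁ hA₁ hB₁ rfl
      exact ⟨A', B', hAA.trans h1, hBB.trans h2, h3, h4⟩
    obtain ⟨x, hxU, hux⟩ := hU u huU
    rw [Finset.mem_union, not_or] at hu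
    by_cases hxA : x ∈ A
    · exact step A (insert u B) subset_rfl (Finset.subset_insert _ _) hA
        (Finset.insert_subset huU hB) (by simp) (h.symm.insert_left hu.1 hxA hux).symm
    by_cases hxB : x ∈ B
    · exact step (insert u A) B (Finset.subset_insert _ _) subset_rfl
        (Finset.insert_subset huU hA) hB (by simp) (h.insert_left hu.2 hxB hux)
    · exact step (insert u A) (insert x B) (Finset.subset_insert _ _) (Finset.subset_insert _ _)
        (Finset.insert_subset huU hA) (Finset.insert_subset hxU hB) (by simp)
        (h.insert_insert hu.2 hxA hux)

/-- A vertex outside a cross pair is allowed if it has a neighbour in the left side. -/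
theorem IsCrossPair.isDominatingSet_left {V : Type*} {G : SimpleGraph V}
    {A B : Finset V} (h : G.IsCrossPair A B)
    (hout : ∀ v, v ∉ A → v ∉ B → ∃ a ∈ A, G.Adj v a) : G.IsDominatingSet A := by
  intro v hv
  by_cases hB : v ∈ B
  · exact h.right v hB
  · exact hout v hv hB

/-! ### Slack -/

/-- There is a multiset of `2 * s` dominating sets that covers every vertex at most `s` times, and
every vertex of `S` fewer than `s` times. The empty multiset is allowed if `S` is empty. -/
def HasSlack {V : Type*} [DecidableEq V] (G : SimpleGraph V) (S : Finset V) : Prop :=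
  ∃ (M : Multiset (Finset V)) (s : ℕ), (∀ D ∈ M, G.IsDominatingSet D) ∧
    Multiset.card M = 2 * s ∧ (∀ u, M.countP (fun D => u ∈ D) ≤ s) ∧
    ∀ u ∈ S, M.countP (fun D => u ∈ D) < s

theorem HasSlack.union {V : Type*} [DecidableEq V] {G : SimpleGraph V} {S T : Finset V}
    (hS : G.HasSlack S) (hT : G.HasSlack T) : G.HasSlack (S ∪ T) := by
  obtain ⟨M, s, hM, hMc, hMs, hMS⟩ := hS
  obtain ⟨N, t, hN, hNc, hNt, hNT⟩ := hT
  refine ⟨M + N, s + t, fun D hD => ?_, ?_, fun u => ?_, fun u hu => ?_⟩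
  · exact (Multiset.mem_add.1 hD).elim (hM D) (hN D)
  · rw [Multiset.card_add]
    omega
  · rw [Multiset.countP_add]
    exact add_le_add (hMs u) (hNt u)
  · rw [Multiset.countP_add]
    rcases Finset.mem_union.1 hu with hu | hu
    · exact add_lt_add_of_lt_of_le (hMS u hu) (hNt u)
    · exact add_lt_add_of_le_of_lt (hMs u) (hNT u hu)

theorem HasSlack.of_forall_singleton {V : Type*} [DecidableEq V] {G : SimpleGraph V} {S : Finset V}
    (h : ∀ v ∈ S, G.HasSlack {v}) : G.HasSlack S := by
  induction S using Finset.induction_on with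
  | empty => exact ⟨0, 0, by simp, by simp, by simp, by simp⟩
  | insert v S _ ih =>
    rw [Finset.insert_eq]
    exact (h v (by simp)).union (ih fun u hu => h u (Finset.mem_insert_of_mem hu))

theorem IsDominatingSet.nonempty {V : Type*} [Nonempty V] {G : SimpleGraph V}
    {D : Finset V} (h : G.IsDominatingSet D) : D.Nonempty := by
  obtain ⟨v⟩ := ‹Nonempty V›
  by_cases hv : v ∈ D
  · exact ⟨v, hv⟩
  · obtain ⟨u, hu, -⟩ := h v hv
    exact ⟨u, hu⟩

theorem HasSlack.two_lt_fractionalDomaticNumber {V : Type*} [Fintype V] [DecidableEq V] [Nonempty V]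
    {G : SimpleGraph V} (h : G.HasSlack Finset.univ) : 2 < G.fractionalDomaticNumber := by
  obtain ⟨M, s, hM, hMc, -, hMs⟩ := h
  replace hMs : ∀ u, M.countP (fun D => u ∈ D) < s := fun u => hMs u (Finset.mem_univ u)
  have hs : 2 ≤ s := by
    have hs0 : 0 < s := (Nat.zero_le _).trans_lt (hMs (Classical.arbitrary V))
    obtain ⟨D, hD⟩ := Multiset.card_pos_iff_exists_mem.1 (show 0 < Multiset.card M by omega)
    obtain ⟨v, hv⟩ := (hM D hD).nonempty
    have h1 : 0 < M.countP (fun D => v ∈ D) := Multiset.countP_pos.2 ⟨D, hD, hv⟩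
    have h2 := hMs v
    omega
  obtain ⟨t, rfl⟩ : ∃ t, s = t + 1 := ⟨s - 1, by omega⟩
  have hmem : ((2 * (t + 1) : ℕ) : ℝ) / (t : ℝ) ∈ G.configurationRatios :=
    ⟨2 * (t + 1), t, by omega, ⟨M, by omega, hMc, hM, fun v => Nat.lt_succ_iff.1 (hMs v)⟩, rfl⟩
  refine lt_of_lt_of_le ?_ (G.isLUB_fractionalDomaticNumber.1 hmem)
  have ht : (0 : ℝ) < t := by exact_mod_cast (show 0 < t by omega)
  rw [lt_div_iff₀ ht]
  push_cast
  linarith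

/-- A cross pair avoiding `v` that has neighbours of `v` on both sides can be grown to two disjoint
dominating sets that both avoid `v`. -/
theorem IsCrossPair.hasSlack_singleton {V : Type*} [Fintype V] [DecidableEq V] {G : SimpleGraph V}
    (h2 : ∀ u x, ∃ y, y ≠ x ∧ G.Adj u y) {v p q : V} {A B : Finset V} (h : G.IsCrossPair A B)
    (hvA : v ∉ A) (hvB : v ∉ B) (hp : p ∈ A) (hq : q ∈ B) (hvp : G.Adj v p) (hvq : G.Adj v q) :
    G.HasSlack {v} := by
  obtain ⟨A', B', hA, hB, hcov, h'⟩ := h.exists_extension (U := Finset.univ.erase v)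
    (fun u _ => by
      obtain ⟨y, hy, huy⟩ := h2 u v
      exact ⟨y, by simpa using hy, huy⟩)
    (fun a ha => by simpa using fun e : a = v => hvA (e ▸ ha))
    (fun b hb => by simpa using fun e : b = v => hvB (e ▸ hb))
  have hout : ∀ u, u ∉ A' → u ∉ B' → u = v := by
    intro u hu1 hu2
    by_contra hne
    have : u ∈ A' ∪ B' := by
      rw [hcov]
      simpa using hne
    simp [hu1, hu2] at this
  have hv : v ∉ A' ∪ B' := by simp [hcov]
  rw [Finset.mem_union, not_or] at hv
  refine ⟨{A', B'}, 1, ?_, by simp, fun u => ?_, ?_⟩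
  · simp only [Multiset.insert_eq_cons, Multiset.mem_cons, Multiset.mem_singleton]
    rintro D (rfl | rfl)
    · refine h'.isDominatingSet_left fun u hu1 hu2 => ?_
      rw [hout u hu1 hu2]
      exact ⟨p, hA hp, hvp⟩
    · refine h'.symm.isDominatingSet_left fun u hu1 hu2 => ?_
      rw [hout u hu2 hu1]
      exact ⟨q, hB hq, hvq⟩
  · have : u ∈ A' → u ∉ B' := fun hu => Finset.disjoint_left.1 h'.disjoint hu
    by_cases hu : u ∈ A' <;> by_cases hu' : u ∈ B' <;> simp_all [← Multiset.cons_zero]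
  · simp [← Multiset.cons_zero, hv]

/-- Either there is slack at `v`, or all neighbours of `v` have degree `2` and share both of their
neighbours `v` and `c`. -/
theorem hasSlack_singleton_or_exists_forall_adj {V : Type*} [Fintype V] [DecidableEq V]
    {G : SimpleGraph V} (h2 : ∀ u x, ∃ y, y ≠ x ∧ G.Adj u y) (v : V) :
    G.HasSlack {v} ∨ ∃ c, c ≠ v ∧ ∀ p, G.Adj v p → ∀ a, G.Adj p a ↔ a = v ∨ a = c := by
  by_cases hv : G.HasSlack {v}
  · exact Or.inl hv
  refine Or.inr ?_
  have hnadj : ∀ p q, G.Adj v p → G.Adj v q → ¬ G.Adj p q := by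
    intro p q hp hq hpq
    refine hv (IsCrossPair.hasSlack_singleton h2 (p := p) (q := q)
      (G.isCrossPair_empty.insert_insert (by simp) (by simp) hpq) ?_ ?_ (by simp) (by simp) hp hq)
    · simpa using hp.ne
    · simpa using hq.ne
  have hcommon : ∀ p q a b, p ≠ q → G.Adj v p → G.Adj v q → G.Adj p a → G.Adj q b → a ≠ v → b ≠ v →
      a = b := by
    intro p q a b hpq hp hq hpa hqb hav hbv
    by_contra hab
    have hqa : q ≠ a := fun e => hnadj p q hp hq (e ▸ hpa)
    have hpb : p ≠ b := fun e => hnadj q p hq hp (e ▸ hqb)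
    refine hv (IsCrossPair.hasSlack_singleton h2 (p := p) (q := q)
      ((G.isCrossPair_empty.insert_insert (u := p) (x := a) (by simp) (by simp)
        hpa).insert_insert (u := b) (x := q) ?_ ?_ hqb.symm) ?_ ?_ (by simp) (by simp) hp hq)
    · simpa using Ne.symm hab
    · simpa using hpq.symm
    · simpa using ⟨hbv.symm, hp.ne⟩
    · simpa using ⟨hq.ne, hav.symm⟩
  obtain ⟨p₀, -, hp₀⟩ := h2 v v
  obtain ⟨q₀, hpq₀, hq₀⟩ := h2 v p₀
  obtain ⟨c, hcv, hc⟩ := h2 p₀ v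
  have honly : ∀ p, G.Adj v p → ∀ a, G.Adj p a → a ≠ v → a = c := by
    have hq : ∀ a, G.Adj q₀ a → a ≠ v → a = c := fun a ha hav =>
      hcommon q₀ p₀ a c hpq₀ hq₀ hp₀ ha hc hav hcv
    intro p hp a ha hav
    by_cases hpp : p = p₀
    · subst hpp
      obtain ⟨b, hbv, hb⟩ := h2 q₀ v
      rw [hcommon p q₀ a b hpq₀.symm hp hq₀ ha hb hav hbv, hq b hb hbv]
    · exact hcommon p p₀ a c hpp hp hp₀ ha hc hav hcv
  refine ⟨c, hcv, fun p hp a => ⟨fun ha => ?_, ?_⟩⟩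
  · by_cases hav : a = v
    · exact Or.inl hav
    · exact Or.inr (honly p hp a ha hav)
  · rintro (rfl | rfl)
    · exact hp.symm
    · obtain ⟨y, hyv, hy⟩ := h2 p v
      exact honly p hp y hy hyv ▸ hy

/-- Slack at all neighbours of `v` passes to `v`, if these neighbours have no other neighbours than
`v` and `c`. -/
theorem HasSlack.singleton_of_neighborFinset {V : Type*} [Fintype V] [DecidableEq V]
    {G : SimpleGraph V} [DecidableRel G.Adj] (h2 : ∀ u x, ∃ y, y ≠ x ∧ G.Adj u y) {v c : V}
    (hc : ∀ p, G.Adj v p → ∀ a, G.Adj p a ↔ a = v ∨ a = c)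
    (hslack : G.HasSlack (G.neighborFinset v)) : G.HasSlack {v} := by
  set L := G.neighborFinset v with hL
  have hLmem : ∀ u, u ∈ L ↔ G.Adj v u := fun u => by simp [hL]
  have hvL : v ∉ L := by simp [hL]
  obtain ⟨p, -, hp⟩ := h2 v v
  -- The vertices outside `L ∪ {v}`, except `c` if it has no neighbour among them.
  let U : Finset V := Finset.univ.filter fun u =>
    u ≠ v ∧ u ∉ L ∧ (u = c → ∃ x, x ≠ v ∧ x ∉ L ∧ G.Adj u x)
  have hUmem : ∀ u, u ∈ U ↔ u ≠ v ∧ u ∉ L ∧ (u = c → ∃ x, x ≠ v ∧ x ∉ L ∧ G.Adj u x) :=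
    fun u => by simp [U]
  have hcL : c ∉ L := by
    intro h
    obtain ⟨y, hyv, hy⟩ := h2 c v
    rcases (hc c ((hLmem c).1 h) y).1 hy with rfl | rfl
    · exact hyv rfl
    · exact hy.ne rfl
  have hnbr : ∀ u, u ≠ v → u ∉ L → u ≠ c → ∀ x, G.Adj u x → x ≠ v ∧ x ∉ L := by
    intro u huv huL huc x hux
    refine ⟨fun e => huL ((hLmem u).2 (e ▸ hux.symm)), fun hxL => ?_⟩
    exact ((hc x ((hLmem x).1 hxL) u).1 hux.symm).elim huv huc
  have hUU : ∀ u ∈ U, ∃ x ∈ U, G.Adj u x := by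
    intro u hu
    obtain ⟨huv, huL, hu3⟩ := (hUmem u).1 hu
    have : ∃ x, x ≠ v ∧ x ∉ L ∧ G.Adj u x := by
      by_cases huc : u = c
      · exact hu3 huc
      · obtain ⟨x, -, hx⟩ := h2 u u
        exact ⟨x, (hnbr u huv huL huc x hx).1, (hnbr u huv huL huc x hx).2, hx⟩
    obtain ⟨x, hxv, hxL, hux⟩ := this
    exact ⟨x, (hUmem x).2 ⟨hxv, hxL, fun _ => ⟨u, huv, huL, hux.symm⟩⟩, hux⟩
  obtain ⟨A, B, -, -, hcov, hAB⟩ := G.isCrossPair_empty.exists_extension hUU (by simp) (by simp)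
  have hout : ∀ u, u ∉ L → u ∉ A → u ∉ B → u = v ∨ u = c := by
    intro u huL hA hB
    by_contra hne
    rw [not_or] at hne
    have : u ∈ A ∪ B := by
      rw [hcov, hUmem]
      exact ⟨hne.1, huL, fun e => (hne.2 e).elim⟩
    simp [hA, hB] at this
  have hdom : ∀ A B, G.IsCrossPair A B → (∀ u, u ∉ L → u ∉ A → u ∉ B → u = v ∨ u = c) →
      G.IsDominatingSet (A ∪ L) := by
    intro A B h hout u hu
    rw [Finset.mem_union, not_or] at hu
    by_cases huB : u ∈ B
    · obtain ⟨a, ha, hua⟩ := h.right u huB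
      exact ⟨a, Finset.mem_union_left _ ha, hua⟩
    · refine ⟨p, Finset.mem_union_right _ ((hLmem p).2 hp), ?_⟩
      exact ((hc p hp u).2 (hout u hu.2 hu.1 huB)).symm
  have hvAB : v ∉ A ∪ B := by
    rw [hcov, hUmem]
    simp
  rw [Finset.mem_union, not_or] at hvAB
  obtain ⟨M, s, hM, hMc, hMs, hML⟩ := hslack
  refine ⟨(A ∪ L) ::ₘ (B ∪ L) ::ₘ M, s + 1, ?_, ?_, fun u => ?_, ?_⟩
  · simp only [Multiset.mem_cons]
    rintro D (rfl | rfl | hD)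
    · exact hdom A B hAB hout
    · exact hdom B A hAB.symm fun u hu hB hA => hout u hu hA hB
    · exact hM D hD
  · simp only [Multiset.card_cons]
    omega
  · have hd : u ∈ A → u ∉ B := fun hu => Finset.disjoint_left.1 hAB.disjoint hu
    have h1 := hMs u
    have h3 := hML u
    simp only [Multiset.countP_cons, Finset.mem_union]
    by_cases huL : u ∈ L
    · have := h3 huL
      simp only [huL, or_true, if_true]
      omega
    · by_cases hA : u ∈ A
      · simp [huL, hA, hd hA]
        omega
      · simp only [huL, hA, or_false, if_false]
        split_ifs <;> omega
  · have := hMs v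
    simp [Multiset.countP_cons, hvAB, hvL]
    omega

/-! ### Components isomorphic to a given graph -/

/-- An injection whose image is closed under taking neighbours and which preserves and reflects
adjacency identifies a connected graph with a component. -/
theorem exists_nonempty_component_iso {V W : Type*} {G : SimpleGraph V} {H : SimpleGraph W}
    (hH : H.Connected) (f : W → V) (hf : Function.Injective f)
    (hadj : ∀ i x, G.Adj (f i) x ↔ ∃ j, H.Adj i j ∧ f j = x) :
    ∃ C : G.ConnectedComponent, Nonempty (C.toSimpleGraph ≃g H) := by
  obtain ⟨i₀⟩ := hH.nonempty
  let φ : H →g G := ⟨f, fun {i j} hij => (hadj i (f j)).2 ⟨j, hij, rfl⟩⟩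
  have hmem : ∀ i, f i ∈ (G.connectedComponentMk (f i₀)).supp := fun i =>
    ConnectedComponent.sound ((hH.preconnected i i₀).map φ)
  have hsurj : ∀ x, G.Reachable (f i₀) x → ∃ i, f i = x := by
    intro x hx
    rw [reachable_iff_reflTransGen] at hx
    induction hx with
    | refl => exact ⟨i₀, rfl⟩
    | tail _ hyz ih =>
      obtain ⟨i, rfl⟩ := ih
      obtain ⟨j, -, hj⟩ := (hadj i _).1 hyz
      exact ⟨j, hj⟩
  let g : W → (G.connectedComponentMk (f i₀)).supp := fun i => ⟨f i, hmem i⟩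
  have hg : Function.Bijective g := by
    refine ⟨fun i j hij => hf (congrArg Subtype.val hij), fun x => ?_⟩
    obtain ⟨i, hi⟩ := hsurj x.1 (ConnectedComponent.exact x.2).symm
    exact ⟨i, Subtype.ext hi⟩
  refine ⟨G.connectedComponentMk (f i₀), ⟨Iso.symm ⟨Equiv.ofBijective g hg, fun {i j} => ?_⟩⟩⟩
  change G.Adj (f i) (f j) ↔ H.Adj i j
  rw [hadj]
  exact ⟨fun ⟨k, hk, hkj⟩ => hf hkj ▸ hk, fun h => ⟨j, h, rfl⟩⟩

theorem exists_component_iso_cycleGraph_four {V : Type*} {G : SimpleGraph V} {v p c d : V}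
    (hvc : v ≠ c) (hpd : p ≠ d) (hv : ∀ a, G.Adj v a ↔ a = p ∨ a = d)
    (hp : ∀ a, G.Adj p a ↔ a = v ∨ a = c) (hc : ∀ a, G.Adj c a ↔ a = p ∨ a = d)
    (hd : ∀ a, G.Adj d a ↔ a = v ∨ a = c) :
    ∃ C : G.ConnectedComponent, Nonempty (C.toSimpleGraph ≃g cycleGraph 4) := by
  have h1 : v ≠ p := ((hv p).2 (Or.inl rfl)).ne
  have h2 : v ≠ d := ((hv d).2 (Or.inr rfl)).ne
  have h3 : c ≠ p := ((hc p).2 (Or.inl rfl)).ne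
  have h4 : c ≠ d := ((hc d).2 (Or.inr rfl)).ne
  have hadj : ∀ i j : Fin 4, (cycleGraph 4).Adj i j ↔ j = i + 1 ∨ j = i + 3 := by decide
  refine exists_nonempty_component_iso (cycleGraph_connected (n := 3)) ![v, p, c, d] ?_ ?_
  · intro i j
    fin_cases i <;> fin_cases j <;> simp_all [eq_comm]
  · intro i x
    simp only [hadj, or_and_right, exists_or, exists_eq_left]
    fin_cases i <;> simp [hv, hp, hc, hd, eq_comm, or_comm]

theorem hasSlack_singleton_of_no_cycleGraph_four {V : Type*} [Fintype V] [DecidableEq V]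
    {G : SimpleGraph V} [DecidableRel G.Adj] (h2 : ∀ u x, ∃ y, y ≠ x ∧ G.Adj u y)
    (hC : ∀ C : G.ConnectedComponent, ¬ Nonempty (C.toSimpleGraph ≃g cycleGraph 4)) (v : V) :
    G.HasSlack {v} := by
  rcases hasSlack_singleton_or_exists_forall_adj h2 v with hv | ⟨c, hcv, hc⟩
  · exact hv
  refine HasSlack.singleton_of_neighborFinset h2 hc (HasSlack.of_forall_singleton fun p hp => ?_)
  rw [mem_neighborFinset] at hp
  rcases hasSlack_singleton_or_exists_forall_adj h2 p with hp' | ⟨d, hdp, hd⟩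
  · exact hp'
  -- Without slack at `p`, the vertices `v`, `p`, `c`, `d` span a component.
  have hvd : G.Adj v d := (hd v hp.symm d).2 (Or.inr rfl)
  obtain ⟨C, hiso⟩ := exists_component_iso_cycleGraph_four hcv.symm hdp.symm (hd v hp.symm)
    (hc p hp) (hd c ((hc p hp c).2 (Or.inr rfl))) (hc d hvd)
  exact (hC C hiso).elim

/-! ### Bounds by double counting -/

theorem fractionalDomaticNumber_le_of_forall_le_card_inter {V : Type*} [Fintype V] [DecidableEq V]
    [Nonempty V] {G : SimpleGraph V} (S : Finset V) {m : ℕ} (hm : 0 < m)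
    (h : ∀ D, G.IsDominatingSet D → m ≤ (S ∩ D).card) :
    G.fractionalDomaticNumber ≤ S.card / m := by
  refine G.isLUB_fractionalDomaticNumber.2 ?_
  rintro r ⟨k, s, hs, ⟨𝒟, -, rfl, hdom, hcov⟩, rfl⟩
  have key : ∀ 𝒜 : Multiset (Finset V), (∀ D ∈ 𝒜, G.IsDominatingSet D) →
      m * Multiset.card 𝒜 ≤ ∑ v ∈ S, Multiset.countP (fun D => v ∈ D) 𝒜 := by
    intro 𝒜
    induction 𝒜 using Multiset.induction_on with
    | empty => simp
    | cons D 𝒜 ih =>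
      intro h𝒜
      have h1 := ih fun E hE => h𝒜 E (Multiset.mem_cons_of_mem hE)
      have h2 := h D (h𝒜 D (Multiset.mem_cons_self D 𝒜))
      have h3 : ∑ v ∈ S, (if v ∈ D then 1 else 0) = (S ∩ D).card := by
        rw [← Finset.card_filter, Finset.filter_mem_eq_inter]
      simp only [Multiset.card_cons, Multiset.countP_cons, Finset.sum_add_distrib, h3, mul_add]
      omega
  have hle : m * Multiset.card 𝒟 ≤ S.card * s :=
    (key 𝒟 hdom).trans ((Finset.sum_le_sum fun v _ => hcov v).trans (by simp))
  rw [div_le_div_iff₀ (by exact_mod_cast hs) (by exact_mod_cast hm), mul_comm]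
  exact_mod_cast hle

theorem fractionalDomaticNumber_le_degree_add_one {V : Type*} [Fintype V] [DecidableEq V]
    [Nonempty V] (G : SimpleGraph V) [DecidableRel G.Adj] (v : V) :
    G.fractionalDomaticNumber ≤ G.degree v + 1 := by
  have := fractionalDomaticNumber_le_of_forall_le_card_inter (G := G)
    (insert v (G.neighborFinset v)) one_pos fun D hD => by
      rw [Nat.one_le_iff_ne_zero, Finset.card_ne_zero]
      by_cases hv : v ∈ D
      · exact ⟨v, by simp [hv]⟩
      · obtain ⟨u, hu, huv⟩ := hD v hv
        exact ⟨u, by simp [hu, huv]⟩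
  simpa using this

theorem fractionalDomaticNumber_le_two_of_iso {V : Type*} [Fintype V] [DecidableEq V]
    [Nonempty V] (G : SimpleGraph V) {C : G.ConnectedComponent}
    (e : C.toSimpleGraph ≃g cycleGraph 4) : G.fractionalDomaticNumber ≤ 2 := by
  let f : Fin 4 ↪ V := e.symm.toEquiv.toEmbedding.trans (Function.Embedding.subtype _)
  have hf : ∀ i u, G.Adj (f i) u → ∃ j, (cycleGraph 4).Adj i j ∧ f j = u := by
    intro i u hu
    have huC : u ∈ C.supp := C.mem_supp_of_adj_mem_supp (e.symm i).2 hu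
    refine ⟨e ⟨u, huC⟩, ?_, ?_⟩
    · have : C.toSimpleGraph.Adj (e.symm i) ⟨u, huC⟩ := hu
      simpa using e.map_adj_iff.2 this
    · change ((e.symm (e ⟨u, huC⟩)) : V) = u
      simp
  have hfour : ∀ T : Finset (Fin 4), (∀ i, i ∉ T → ∃ j ∈ T, (cycleGraph 4).Adj i j) →
      2 ≤ T.card := by decide
  have := fractionalDomaticNumber_le_of_forall_le_card_inter (G := G) (Finset.univ.map f) two_pos
    fun D hD => by
      refine (hfour (Finset.univ.filter fun i => f i ∈ D) fun i hi => ?_).trans ?_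
      · obtain ⟨u, hu, hiu⟩ := hD (f i) (by simpa using hi)
        obtain ⟨j, hij, rfl⟩ := hf i u hiu
        exact ⟨j, by simpa using hu, hij⟩
      · rw [← Finset.card_map f]
        refine Finset.card_le_card fun x hx => ?_
        simp only [Finset.mem_map, Finset.mem_filter, Finset.mem_univ, true_and] at hx
        obtain ⟨i, hi, rfl⟩ := hx
        simp [hi]
  refine this.trans_eq ?_
  norm_num

theorem two_le_fractionalDomaticNumber {V : Type*} [Fintype V] [DecidableEq V] [Nonempty V]
    (G : SimpleGraph V) (h : ∀ v, ∃ u, G.Adj v u) : 2 ≤ G.fractionalDomaticNumber := by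
  obtain ⟨A, B, -, -, hcov, hAB⟩ := G.isCrossPair_empty.exists_extension (U := Finset.univ)
    (fun v _ => by simpa using h v) (by simp) (by simp)
  have hout : ∀ v, v ∉ A → v ∉ B → False := fun v hA hB => by
    have : v ∈ A ∪ B := by simp [hcov]
    simp [hA, hB] at this
  refine G.isLUB_fractionalDomaticNumber.1
    ⟨2, 1, le_rfl, ⟨{A, B}, by omega, by simp, ?_, fun v => ?_⟩, by simp⟩
  · simp only [Multiset.insert_eq_cons, Multiset.mem_cons, Multiset.mem_singleton]
    rintro D (rfl | rfl)
    · exact hAB.isDominatingSet_left fun v hA hB => (hout v hA hB).elim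
    · exact hAB.symm.isDominatingSet_left fun v hB hA => (hout v hA hB).elim
  · have : v ∈ A → v ∉ B := fun hv => Finset.disjoint_left.1 hAB.disjoint hv
    by_cases hu : v ∈ A <;> by_cases hu' : v ∈ B <;> simp_all [← Multiset.cons_zero]

/-! ### The characterization -/

theorem two_lt_fractionalDomaticNumber_iff {V : Type*} [Fintype V] [DecidableEq V] [Nonempty V]
    (G : SimpleGraph V) [DecidableRel G.Adj] :
    2 < G.fractionalDomaticNumber ↔ 2 ≤ G.minDegree ∧
      ∀ C : G.ConnectedComponent, ¬ Nonempty (C.toSimpleGraph ≃g cycleGraph 4) := by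
  constructor
  · intro h
    refine ⟨G.le_minDegree_of_forall_le_degree 2 fun v => ?_, ?_⟩
    · have h1 := h.trans_le (G.fractionalDomaticNumber_le_degree_add_one v)
      have h2 : 2 < G.degree v + 1 := by exact_mod_cast h1
      omega
    · rintro C ⟨e⟩
      exact (G.fractionalDomaticNumber_le_two_of_iso e).not_gt h
  · rintro ⟨hdeg, hC⟩
    have h2 : ∀ u x, ∃ y, y ≠ x ∧ G.Adj u y := by
      intro u x
      obtain ⟨y, hy, hyx⟩ := Finset.exists_mem_ne
        (show 1 < (G.neighborFinset u).card from hdeg.trans (G.minDegree_le_degree u)) x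
      exact ⟨y, hyx, by simpa using hy⟩
    exact (HasSlack.of_forall_singleton fun v _ =>
      hasSlack_singleton_of_no_cycleGraph_four h2 hC v).two_lt_fractionalDomaticNumber

end SimpleGraph

theorem theorem1 {V : Type*} [Fintype V] [DecidableEq V] [Nonempty V]
    (G : SimpleGraph V) [DecidableRel G.Adj] :
    ((∀ v, ¬ G.IsIsolated v) →
      (G.fractionalDomaticNumber = 2 ↔
        (∃ v, G.degree v = 1) ∨
          ∃ C : G.ConnectedComponent,
            Nonempty (C.toSimpleGraph ≃g SimpleGraph.cycleGraph 4))) ∧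
    (2 < G.fractionalDomaticNumber ↔
      2 ≤ G.minDegree ∧
        ∀ C : G.ConnectedComponent,
          ¬ Nonempty (C.toSimpleGraph ≃g SimpleGraph.cycleGraph 4)) := by
  refine ⟨fun hiso => ?_, G.two_lt_fractionalDomaticNumber_iff⟩
  have hadj : ∀ v, ∃ u, G.Adj v u := fun v => by
    by_contra! h
    exact hiso v fun u => h u
  have hpos : ∀ v, 0 < G.degree v := fun v => (G.degree_pos_iff_exists_adj v).2 (hadj v)
  rw [(G.two_le_fractionalDomaticNumber hadj).ge_iff_eq'.symm, ← not_lt,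
    G.two_lt_fractionalDomaticNumber_iff, not_and_or]
  push Not
  refine or_congr ⟨fun h => ?_, ?_⟩ Iff.rfl
  · obtain ⟨v, hv⟩ := G.exists_minimal_degree_vertex
    have := hpos v
    exact ⟨v, by omega⟩
  · rintro ⟨v, hv⟩
    have := G.minDegree_le_degree v
    omega
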